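/- Let $\#\mathrm{P}$ be the class of functions $f:\{0,1\}^*\to\mathbb N$ (where $\mathbb N=\{0,1,2,\dots\}$) for which there is a nondeterministic polynomial-time Turing machine whose number of accepting computation paths on every input $w$ is $f(w)$. Let $\mathrm{UP}$ be the class of languages $L\subseteq\{0,1\}^*$ whose characteristic function is in $\#\mathrm{P}$, and let $\mathrm{coUP}$ be the class of complements of languages in $\mathrm{UP}$. A function $\varphi:\mathbb N^k\to\mathbb N$ is a closure property of $\#\mathrm{P}$ if for all $f_1,\dots,f_k\in\#\mathrm{P}$ the function $w\mapsto\varphi(f_1(w),\dots,f_k(w))$ is in $\#\mathrm{P}$; it is monotone if $\varphi(a_1,\dots,a_k)\le\varphi(a_1',\dots,a_k')$ whenever $a_i\le a_i'$ for all $i$. For $\varphi,\psi\in\mathbb Q[x_1,\dots,x_k]$ write $\varphi\geqslant_\#\psi$ if $\varphi(f_1,\dots,f_k)-\psi(f_1,\dots,f_k)\in\#\mathrm{P}$ for all $f_1,\dots,f_k\in\#\mathrm{P}$. Fix $k\ge 1$. If there is a closure property $\varphi:\mathbb N^k\to\mathbb N$ of $\#\mathrm{P}$ that is not monotone, then $\mathrm{UP}=\mathrm{coUP}$.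 Moreover, each of the following relations implies $\mathrm{UP}=\mathrm{coUP}$: 1. $(x-1)^2\geqslant_\# 0$; 2. $a^2+b^2\geqslant_\# ab$ (and likewise $a^2-ab+b^2\geqslant_\# 0$); 3. $x^2y^4+x^4y^2-3x^2y^2+1\geqslant_\# 0$ (the Motzkin polynomial). -/

import Mathlib

/-- A nondeterministic multitape Turing machine on binary inputs. The tapes, infinite in both
directions, are indexed by `Option Work`: the tape `none` holds the input at the start, and the
tapes `some w` are the work tapes. An action consists of a new state and, for every tape, the symbol
to write and the move of the head (`none` for a head that stays in place). -/
structure NTM where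
  /-- the states -/
  State : Type
  /-- the tape symbols -/
  Symbol : Type
  /-- the indices of the work tapes -/
  Work : Type
  [finite_state : Finite State]
  [finite_symbol : Finite Symbol]
  [finite_work : Finite Work]
  /-- the blank symbol (the image of `none`) and the two input symbols -/
  sym : Option Bool ↪ Symbol
  /-- the initial state -/
  start : State
  /-- the accepting states -/
  accept : Set State
  /-- the set of actions that are allowed in a given state, given the scanned symbols -/
  δ : State → (Option Work → Symbol) → Set (State × (Option Work → Symbol × Option Turing.Dir))

namespace NTM

/-- The default symbol is the blank, which fills the unused part of a tape. -/
instance (M : NTM) : Inhabited M.Symbol := ⟨M.sym none⟩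

/-- The actions of a machine. -/
abbrev Action (M : NTM) : Type := M.State × (Option M.Work → M.Symbol × Option Turing.Dir)

/-- The configurations of a machine. -/
structure Config (M : NTM) where
  /-- the current state -/
  state : M.State
  /-- the contents of the tapes, seen from the heads -/
  tape : Option M.Work → Turing.Tape M.Symbol

/-- The initial configuration on the input `x`: the head of the input tape is on the first
symbol of `x`, and all work tapes are blank. -/
def init (M : NTM) (x : List Bool) : M.Config where
  state := M.start
  tape
    | none => Turing.Tape.mk₁ (x.map fun b => M.sym (some b))
    | some _ => Turing.Tape.mk₁ []

/-- The actions that are possible in a configuration. -/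
def enabled (M : NTM) (c : M.Config) : Set M.Action := M.δ c.state fun i => (c.tape i).head

/-- The motion of a head. -/
def moveHead {M : NTM} (T : Turing.Tape M.Symbol) : Option Turing.Dir → Turing.Tape M.Symbol
  | none => T
  | some d => T.move d

/-- The configuration after an action: write, then move. -/
def step (M : NTM) (c : M.Config) (a : M.Action) : M.Config where
  state := a.1
  tape i := moveHead ((c.tape i).write (a.2 i).1) (a.2 i).2

/-- `M.IsPath c l` says that the list `l` of successive actions can be carried out from `c`, that
is, that `l` is a (not necessarily complete) computation path from `c`. -/
def IsPath (M : NTM) : M.Config → List M.Action → Prop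
  | _, [] => True
  | c, a :: l => a ∈ M.enabled c ∧ M.IsPath (M.step c a) l

/-- The configuration at the end of a computation path. -/
def final (M : NTM) (c : M.Config) (l : List M.Action) : M.Config := l.foldl M.step c

/-- The accepting paths on the input `x`: the computation paths from the initial configuration
that end by halting (no action is possible) in an accepting state. -/
def acceptingPaths (M : NTM) (x : List Bool) : Set (List M.Action) :=
  {l | M.IsPath (M.init x) l ∧ M.enabled (M.final (M.init x) l) = ∅ ∧
    (M.final (M.init x) l).state ∈ M.accept}

/-- `M` runs in polynomial time: on every input, the length of every computation path is bounded
by a polynomial in the length of the input. -/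
def PolyTime (M : NTM) : Prop :=
  ∃ p : Polynomial ℕ, ∀ (x : List Bool) (l : List M.Action),
    M.IsPath (M.init x) l → l.length ≤ p.eval x.length

end NTM

/-- The class #P: functions that count the accepting paths of a nondeterministic polynomial time
Turing machine. -/
def SharpP : Set (List Bool → ℕ) :=
  {f | ∃ M : NTM, M.PolyTime ∧ ∀ x, (M.acceptingPaths x).encard = f x}

/-- The class UP: languages whose characteristic function is in #P. -/
def UP : Set (Set (List Bool)) := {L | L.indicator (fun _ => 1) ∈ SharpP}

/-- The class coUP: complements of the languages in UP. -/
def coUP : Set (Set (List Bool)) := {L | Lᶜ ∈ UP}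

/-- `φ` is a closure property of #P. -/
def IsClosureProperty {k : ℕ} (φ : (Fin k → ℕ) → ℕ) : Prop :=
  ∀ f : Fin k → List Bool → ℕ, (∀ i, f i ∈ SharpP) → (fun w => φ fun i => f i w) ∈ SharpP

/-- The relation `φ ≥_# ψ` between rational polynomials: `φ(f₁, …, f_k) - ψ(f₁, …, f_k)` is in #P
for all `f₁, …, f_k` in #P. -/
def SharpGE {k : ℕ} (φ ψ : MvPolynomial (Fin k) ℚ) : Prop :=
  ∀ f : Fin k → List Bool → ℕ, (∀ i, f i ∈ SharpP) →
    ∃ g ∈ SharpP, ∀ w, (g w : ℚ) =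
      MvPolynomial.eval (fun i => (f i w : ℚ)) φ - MvPolynomial.eval (fun i => (f i w : ℚ)) ψ

/-!
Complementing a language `L` in UP amounts to turning an accepting path on `L` into none, and none
into one. If a function `Φ` of functions in #P is in #P and decreases from `n = Φ a` to
`m = Φ (a + eᵢ)`, insert the constants `a`, with the characteristic function of `L` added to the
`i`-th one. The result is a function `g` in #P with `g = m < n` on `L` and `g = n` elsewhere, and so
`g.choose n` is the characteristic function of the complement of `L` (`compl_mem_UP`,
`UP_eq_coUP_of_decrease`). A function that is not monotone decreases in some unit step
(`exists_lt_of_not_monotone`), and so do the polynomials: `(x - 1)²` from `x = 0` to `1`,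
`a² - ab + b²` from `(2, 0)` to `(2, 1)`, with the values `4` and `3`, and the Motzkin polynomial from
`(1, 0)` to `(1, 1)`, with the values `1` and `0`.

Two closure properties of #P are needed. Adding a constant (`SharpP.add_const`) takes a machine with
more branches at the start. For `f ↦ f.choose n` (`SharpP.choose`), the machine `NTM.choose` makes
`n` copies of the input, on separate tapes, and then runs `n` copies of the machine for `f` in
parallel. The copies that have halted idle. The state keeps, for every two copies, the result of the
lexicographic comparison of their paths so far; the machine accepts if all copies accept and their
paths increase. Its accepting paths thus correspond to the increasing `n`-tuples of accepting paths,
that is, to the sets of `n` accepting paths.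
-/

attribute [instance] NTM.finite_state NTM.finite_symbol NTM.finite_work

namespace NTM

/-! ### Accepting paths from an arbitrary configuration -/

/-- The accepting paths that start in the configuration `c`. -/
def accPaths (M : NTM) (c : M.Config) : Set (List M.Action) :=
  {l | M.IsPath c l ∧ M.enabled (M.final c l) = ∅ ∧ (M.final c l).state ∈ M.accept}

theorem nil_mem_accPaths {M : NTM} {c : M.Config} :
    [] ∈ M.accPaths c ↔ M.enabled c = ∅ ∧ c.state ∈ M.accept := by
  simp [accPaths, IsPath, final]

theorem cons_mem_accPaths {M : NTM} {c : M.Config} {a : M.Action} {l : List M.Action} :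
    a :: l ∈ M.accPaths c ↔ a ∈ M.enabled c ∧ l ∈ M.accPaths (M.step c a) := by
  simp [accPaths, IsPath, final, and_assoc]

theorem eq_nil_of_mem_accPaths {M : NTM} {c : M.Config} {l : List M.Action}
    (h : M.enabled c = ∅) (hl : l ∈ M.accPaths c) : l = [] := by
  cases l with
  | nil => rfl
  | cons a l => simp [cons_mem_accPaths, h] at hl

/-- All computation paths from `c` have length at most `t`. -/
def Bounded (M : NTM) (c : M.Config) (t : ℕ) : Prop :=
  ∀ l, M.IsPath c l → l.length ≤ t

theorem bounded_of_enabled_eq_empty {M : NTM} {c : M.Config} (h : M.enabled c = ∅) (t : ℕ) :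
    M.Bounded c t := by
  rintro (_ | ⟨a, l⟩) hl
  · simp
  · simp [IsPath, h] at hl

theorem bounded_succ_iff {M : NTM} {c : M.Config} {t : ℕ} :
    M.Bounded c (t + 1) ↔ ∀ a ∈ M.enabled c, M.Bounded (M.step c a) t := by
  constructor
  · intro h a ha l hl
    simpa using h (a :: l) ⟨ha, hl⟩
  · rintro h (_ | ⟨a, l⟩) hl
    · simp
    · simpa using h a hl.1 l hl.2

theorem bounded_zero_iff {M : NTM} {c : M.Config} : M.Bounded c 0 ↔ M.enabled c = ∅ := by
  refine ⟨fun h => ?_, fun h => bounded_of_enabled_eq_empty h 0⟩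
  rw [Set.eq_empty_iff_forall_notMem]
  intro a ha
  simpa using h [a] ⟨ha, trivial⟩

/-- From `c` there are exactly `N` accepting paths, and no path is longer than `t`. -/
def Counts (M : NTM) (c : M.Config) (N t : ℕ) : Prop :=
  (M.accPaths c).encard = N ∧ M.Bounded c t

/-- A deterministic step changes neither the number of accepting paths nor, up to `1`, the time. -/
theorem Counts.of_step {M : NTM} {c : M.Config} {N t : ℕ} {a : M.Action}
    (ha : M.enabled c = {a}) (h : M.Counts (M.step c a) N t) : M.Counts c N (t + 1) := by
  refine ⟨?_, bounded_succ_iff.2 (by simpa [ha] using h.2)⟩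
  have : M.accPaths c = List.cons a '' M.accPaths (M.step c a) := by
    ext l
    cases l with
    | nil => simp [nil_mem_accPaths, ha]
    | cons b l =>
      simp only [cons_mem_accPaths, ha, Set.mem_singleton_iff, Set.mem_image, List.cons.injEq]
      constructor
      · rintro ⟨rfl, hl⟩
        exact ⟨l, hl, rfl, rfl⟩
      · rintro ⟨l', hl, rfl, rfl⟩
        exact ⟨rfl, hl⟩
  rw [this, (List.cons_injective).encard_image, h.1]

end NTM

theorem mem_sharpP_of_counts {f : List Bool → ℕ} (M : NTM) (p : Polynomial ℕ)
    (h : ∀ x, M.Counts (M.init x) (f x) (p.eval x.length)) : f ∈ SharpP :=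
  ⟨M, ⟨p, fun x => (h x).2⟩, fun x => (h x).1⟩

/-! ### Constants and successors -/

theorem zero_mem_sharpP : (fun _ => 0) ∈ SharpP := by
  let M : NTM :=
    { State := Unit, Symbol := Option Bool, Work := Empty, sym := Function.Embedding.refl _,
      start := (), accept := ∅, δ := fun _ _ => ∅ }
  refine mem_sharpP_of_counts M 0 fun x => ⟨?_, NTM.bounded_of_enabled_eq_empty rfl _⟩
  simp [NTM.accPaths, M]

namespace NTM

/-- The machine with one more accepting path than `M`: its initial state `inr false` may go over,
without touching the tapes, to the initial state of `M` or to the halting state `inr true`. -/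
def addOne (M : NTM) : NTM where
  State := M.State ⊕ Bool
  Symbol := M.Symbol
  Work := M.Work
  sym := M.sym
  start := .inr false
  accept := insert (.inr true) (Sum.inl '' M.accept)
  δ q s := match q with
    | .inl q => (fun a => (.inl a.1, a.2)) '' M.δ q s
    | .inr false => {(.inl M.start, fun i => (s i, none)), (.inr true, fun i => (s i, none))}
    | .inr true => ∅

/-- A configuration of `M` as a configuration of `M.addOne`. -/
def addOneConfig {M : NTM} (c : M.Config) : M.addOne.Config := ⟨.inl c.state, c.tape⟩

/-- An action of `M` as an action of `M.addOne`. -/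
def addOneAction {M : NTM} (a : M.Action) : M.addOne.Action := (.inl a.1, a.2)

theorem addOneAction_injective {M : NTM} : Function.Injective (addOneAction (M := M)) := by
  intro a b h
  exact Prod.ext (Sum.inl_injective (congrArg Prod.fst h)) (congrArg Prod.snd h :)

theorem enabled_addOneConfig {M : NTM} (c : M.Config) :
    M.addOne.enabled (addOneConfig c) = addOneAction '' M.enabled c := rfl

theorem step_addOneConfig {M : NTM} (c : M.Config) (a : M.Action) :
    M.addOne.step (addOneConfig c) (addOneAction a) = addOneConfig (M.step c a) := rfl

theorem mem_accept_addOneConfig {M : NTM} (c : M.Config) :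
    (addOneConfig c).state ∈ M.addOne.accept ↔ c.state ∈ M.accept := by
  change (Sum.inl c.state : M.State ⊕ Bool) ∈ insert (Sum.inr true) (Sum.inl '' M.accept) ↔ _
  simp

theorem accPaths_addOneConfig {M : NTM} (c : M.Config) :
    M.addOne.accPaths (addOneConfig c) = List.map addOneAction '' M.accPaths c := by
  ext l
  induction l generalizing c with
  | nil =>
    simp only [nil_mem_accPaths, enabled_addOneConfig, Set.image_eq_empty, Set.mem_image,
      List.map_eq_nil_iff, exists_eq_right, mem_accept_addOneConfig]
  | cons b l ih =>
    simp only [cons_mem_accPaths, enabled_addOneConfig, Set.mem_image]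
    constructor
    · rintro ⟨⟨a, ha, rfl⟩, hl⟩
      rw [step_addOneConfig, ih] at hl
      obtain ⟨l, hl, rfl⟩ := hl
      exact ⟨a :: l, cons_mem_accPaths.2 ⟨ha, hl⟩, rfl⟩
    · rintro ⟨_ | ⟨a, l'⟩, hl, h⟩
      · simp at h
      · rw [List.map_cons, List.cons.injEq] at h
        obtain ⟨rfl, rfl⟩ := h
        rw [cons_mem_accPaths] at hl
        rw [step_addOneConfig, ih]
        exact ⟨⟨a, hl.1, rfl⟩, _, hl.2, rfl⟩

theorem bounded_addOneConfig {M : NTM} {c : M.Config} {t : ℕ} (h : M.Bounded c t) :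
    M.addOne.Bounded (addOneConfig c) t := by
  induction t generalizing c with
  | zero =>
    rw [bounded_zero_iff] at h ⊢
    rw [enabled_addOneConfig, h, Set.image_empty]
  | succ t ih =>
    rw [bounded_succ_iff] at h ⊢
    rw [enabled_addOneConfig]
    rintro _ ⟨a, ha, rfl⟩
    exact ih (h a ha)

theorem counts_addOne {M : NTM} {x : List Bool} {N t : ℕ} (h : M.Counts (M.init x) N t) :
    M.addOne.Counts (M.addOne.init x) (N + 1) (t + 1) := by
  set c := M.addOne.init x with hc
  let s : Option M.Work → M.Symbol × Option Turing.Dir := fun i => ((c.tape i).head, none)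
  let a₁ : M.addOne.Action := (.inl M.start, s)
  let a₂ : M.addOne.Action := (.inr true, s)
  have hen : M.addOne.enabled c = {a₁, a₂} := rfl
  have htape : ∀ i, moveHead ((c.tape i).write (s i).1) (s i).2 = c.tape i := fun i =>
    Turing.Tape.write_self _
  have h₁ : M.addOne.step c a₁ = addOneConfig (M.init x) := by
    refine congrArg (Config.mk (M := M.addOne) (Sum.inl M.start)) (funext fun i => ?_)
    refine (htape i).trans ?_
    cases i <;> rfl
  have h₂ : M.addOne.enabled (M.addOne.step c a₂) = ∅ := rfl
  constructor
  · have : M.addOne.accPaths c =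
        insert [a₂] (List.cons a₁ '' (List.map addOneAction '' M.accPaths (M.init x))) := by
      ext l
      cases l with
      | nil => simp [nil_mem_accPaths, hen, (Set.insert_nonempty a₁ {a₂}).ne_empty]
      | cons b l =>
        rw [cons_mem_accPaths, hen]
        constructor
        · rintro ⟨rfl | rfl, hl⟩
          · rw [h₁, accPaths_addOneConfig] at hl
            exact .inr ⟨l, hl, rfl⟩
          · exact .inl (by rw [eq_nil_of_mem_accPaths h₂ hl])
        · rintro (h | ⟨l', hl, h⟩)
          · obtain ⟨rfl, rfl⟩ := List.cons.inj h
            exact ⟨.inr rfl, nil_mem_accPaths.2 ⟨h₂, .inl rfl⟩⟩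
          · obtain ⟨rfl, rfl⟩ := List.cons.inj h
            rw [h₁, accPaths_addOneConfig]
            exact ⟨.inl rfl, hl⟩
    rw [this, Set.encard_insert_of_notMem, List.cons_injective.encard_image,
      (List.map_injective_iff.2 addOneAction_injective).encard_image, h.1]
    · norm_cast
    · rintro ⟨l, -, h⟩
      have h' : (Sum.inl M.start : M.State ⊕ Bool) = Sum.inr true :=
        congrArg Prod.fst (List.cons.inj h).1
      simp at h'
  · rw [bounded_succ_iff, hen]
    rintro a (rfl | rfl)
    · rw [h₁]
      exact bounded_addOneConfig h.2
    · exact bounded_of_enabled_eq_empty h₂ t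

end NTM

theorem SharpP.exists_counts {f : List Bool → ℕ} (hf : f ∈ SharpP) :
    ∃ (M : NTM) (p : Polynomial ℕ), ∀ x, M.Counts (M.init x) (f x) (p.eval x.length) := by
  obtain ⟨M, ⟨p, hp⟩, hM⟩ := hf
  exact ⟨M, p, fun x => ⟨hM x, hp x⟩⟩

theorem SharpP.add_const {f : List Bool → ℕ} (hf : f ∈ SharpP) (a : ℕ) :
    (fun x => f x + a) ∈ SharpP := by
  induction a with
  | zero => exact hf
  | succ a ih =>
    obtain ⟨M, p, h⟩ := SharpP.exists_counts ih
    exact mem_sharpP_of_counts M.addOne (p + 1) fun x => by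
      simpa [add_assoc] using NTM.counts_addOne (h x)

theorem SharpP.const (a : ℕ) : (fun _ => a) ∈ SharpP := by
  simpa using SharpP.add_const zero_mem_sharpP a

/-! ### Counting increasing tuples -/

/-- A set with `N` elements has `N.choose n` increasing `n`-tuples. -/
theorem encard_strictMono_tuples {α : Type*} [LinearOrder α] {S : Set α} {N : ℕ}
    (hS : S.encard = N) (n : ℕ) :
    {p : Fin n → α | (∀ j, p j ∈ S) ∧ ∀ i j, i < j → p i < p j}.encard = N.choose n := by
  have hfin : Finite S := Set.finite_of_encard_eq_coe hS
  let F : (Fin n ↪o S) → Fin n → α := fun e j => e j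
  have hF : Function.Injective F := fun e e' h => by
    ext j
    exact congrFun h j
  have hrange : {p : Fin n → α | (∀ j, p j ∈ S) ∧ ∀ i j, i < j → p i < p j} = Set.range F := by
    ext p
    constructor
    · rintro ⟨hp, hlt⟩
      exact ⟨OrderEmbedding.ofStrictMono (fun j => ⟨p j, hp j⟩) fun i j h => hlt i j h, rfl⟩
    · rintro ⟨e, rfl⟩
      exact ⟨fun j => (e j).2, fun i j h => e.strictMono h⟩
  have hcard : Nat.card S = N := by
    rw [Nat.card_coe_set_eq, Set.ncard, hS, ENat.toNat_natCast]
  rw [hrange, ← Set.image_univ, hF.encard_image, Set.encard_univ, ENat.card_congr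
    Set.powersetCard.ofFinEmbEquiv, ENat.card_eq_coe_natCard, Set.powersetCard.card, hcard]

/-- Refine the results `D` of lexicographic comparisons by the next entries `a`, where `none` stands
for the end of a list. -/
def refineOrdering {n : ℕ} {A : Type} [LinearOrder A] (D : Fin n → Fin n → Ordering)
    (a : Fin n → Option A) (i j : Fin n) : Ordering :=
  (D i j).then (compare (a i).toList (a j).toList)

/-- The list `p` precedes `q` lexicographically, if their parts before have compared as `d`. -/
def PrecedesAfter {A : Type} [LinearOrder A] (d : Ordering) (p q : List A) : Prop :=
  d = .lt ∨ d = .eq ∧ p < q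

/-- The lists `a.toList ++ p` and `b.toList ++ q` are compared by comparing their first entries and, if
these agree, the remainders. -/
theorem precedesAfter_append {A : Type} [LinearOrder A] {d : Ordering} {a b : Option A}
    {p q : List A} (ha : a = none → p = []) (hb : b = none → q = []) :
    PrecedesAfter d (a.toList ++ p) (b.toList ++ q) ↔
      PrecedesAfter (d.then (compare a.toList b.toList)) p q := by
  unfold PrecedesAfter
  cases d
  · simp
  · simp only [Ordering.then]
    rcases a with _ | a <;> rcases b with _ | b
    · simp [ha rfl, hb rfl]
    · simp [ha rfl]
    · simp [hb rfl]
    · simp [List.cons_lt_cons_iff, compare_lt_iff_lt]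
  · simp [Ordering.then]

namespace NTM

/-! ### Tapes that hold a binary word -/

section WordTape

variable {M : NTM}

/-- The tape with the word `l.reverse ++ r`, with the head at the beginning of `r`. -/
def wordTape (M : NTM) (l r : List Bool) : Turing.Tape M.Symbol :=
  Turing.Tape.mk₂ (l.map fun b => M.sym (some b)) (r.map fun b => M.sym (some b))

theorem wordTape_head_nil (l : List Bool) : (wordTape M l []).head = M.sym none := rfl

theorem wordTape_head_cons (l r : List Bool) (b : Bool) :
    (wordTape M l (b :: r)).head = M.sym (some b) := rfl

theorem sym_some_ne_blank (b : Bool) : M.sym (some b) ≠ M.sym none :=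
  fun h => by simpa using M.sym.injective h

theorem move_right_wordTape (l r : List Bool) (b : Bool) :
    (wordTape M l (b :: r)).move .right = wordTape M (b :: l) r := by
  simp [wordTape, Turing.Tape.mk₂]

theorem write_wordTape_nil (l : List Bool) (b : Bool) :
    (wordTape M l []).write (M.sym (some b)) = wordTape M l [b] := by
  simp [wordTape, Turing.Tape.mk₂]

end WordTape

/-! ### Running several copies of a machine -/

section Choose

/-- The states of the machine that runs `n` copies of a machine with states `Q` and actions `A`. -/
inductive ChooseState (n : ℕ) (Q A : Type)
  /-- the input is being copied, from left to right -/
  | forward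
  /-- the heads are returning to the first symbol -/
  | backward
  /-- the copies run; `σ` holds their states, `D i j` is the result of comparing what the copies `i`
  and `j` have done so far, and `a` holds the actions that led here (`none` for a halted copy) -/
  | run (σ : Fin n → Q) (D : Fin n → Fin n → Ordering) (a : Fin n → Option A)

instance : Finite Turing.Dir :=
  Finite.of_surjective (fun b : Bool => if b then .left else .right)
    (by rintro (_ | _); exacts [⟨true, rfl⟩, ⟨false, rfl⟩])

instance (n : ℕ) (Q A : Type) [Finite Q] [Finite A] : Finite (ChooseState n Q A) :=
  Finite.of_surjective
    (fun x : Option (Option ((Fin n → Q) × (Fin n → Fin n → Ordering) × (Fin n → Option A))) =>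
      match x with
      | none => .forward
      | some none => .backward
      | some (some x) => .run x.1 x.2.1 x.2.2)
    (by
      rintro (_ | _ | ⟨σ, D, a⟩)
      exacts [⟨none, rfl⟩, ⟨some none, rfl⟩, ⟨some (some (σ, D, a)), rfl⟩])

/-- Joint actions of `n` copies, of which the `j`-th may perform the actions in `E j`: the copies
without a possible action idle, all the others act, and not all copies idle. -/
def IsJoint {n : ℕ} {A : Type} (E : Fin n → Set A) (a : Fin n → Option A) : Prop :=
  (∃ j, a j ≠ none) ∧ ∀ j, (∀ b, a j = some b → b ∈ E j) ∧ (a j = none → E j = ∅)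

variable {M : NTM} {n : ℕ}

/-- The configurations of the copies after a joint action. -/
def jointStep (c : Fin n → M.Config) (a : Fin n → Option M.Action) (j : Fin n) : M.Config :=
  (a j).elim (c j) (M.step (c j))

/-- Given the joint action `a`, an accepting path of a copy from `c j` is the action of that copy in
`a`, if it does not idle, followed by an accepting path from the next configuration. -/
theorem toList_append_mem_accPaths {c : Fin n → M.Config} {a : Fin n → Option M.Action}
    (ha : IsJoint (fun j => M.enabled (c j)) a) (j : Fin n) (l : List M.Action) :
    (a j).toList ++ l ∈ M.accPaths (c j) ↔ l ∈ M.accPaths (jointStep c a j) := by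
  unfold jointStep
  cases hj : a j with
  | none => simp
  | some b => simp [cons_mem_accPaths, (ha.2 j).1 b hj]

theorem eq_nil_of_mem_accPaths_jointStep {c : Fin n → M.Config} {a : Fin n → Option M.Action}
    (ha : IsJoint (fun j => M.enabled (c j)) a) {j : Fin n} {l : List M.Action}
    (hl : l ∈ M.accPaths (jointStep c a j)) (hj : a j = none) : l = [] := by
  rw [jointStep, hj] at hl
  exact eq_nil_of_mem_accPaths ((ha.2 j).2 hj) hl

/-- What happens on the tapes of `M.choose n` when the input is copied: the symbol `s` is written to
the input tape and its copies, and their heads move in the direction `d`. -/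
def copyTapes (M : NTM) (n : ℕ) (s : M.Symbol) (d : Turing.Dir) :
    Option (Fin n × Option M.Work) → M.Symbol × Option Turing.Dir
  | none => (s, some d)
  | some (_, none) => (s, some d)
  | some (_, some _) => (M.sym none, none)

/-- What happens on the tapes of `M.choose n` in the joint action `a`, if the symbols `s` are
scanned. -/
def runTapes (s : Option (Fin n × Option M.Work) → M.Symbol) (a : Fin n → Option M.Action) :
    Option (Fin n × Option M.Work) → M.Symbol × Option Turing.Dir
  | none => (s none, none)
  | some (j, i) => (a j).elim (s (some (j, i)), none) (fun b => b.2 i)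

open Classical in
/-- The machine whose accepting paths are the increasing `n`-tuples of accepting paths of `M`. It has
`n` copies of the tapes of `M`. First it copies the input to the `n` copies of the input tape and
moves the heads back; then it runs `n` copies of `M` in parallel. -/
def choose (M : NTM) [LinearOrder M.Action] (n : ℕ) : NTM where
  State := ChooseState n M.State M.Action
  Symbol := M.Symbol
  Work := Fin n × Option M.Work
  sym := M.sym
  start := .forward
  accept := {q | ∃ σ D a, q = .run σ D a ∧ (∀ j, σ j ∈ M.accept) ∧ ∀ i j, i < j → D i j = .lt}
  δ q s := match q with
    | .forward =>
      {if s none = M.sym none then (.backward, M.copyTapes n (s none) .left)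
        else (.forward, M.copyTapes n (s none) .right)}
    | .backward =>
      {if s none = M.sym none then
          (.run (fun _ => M.start) (fun _ _ => .eq) fun _ => none, M.copyTapes n (s none) .right)
        else (.backward, M.copyTapes n (s none) .left)}
    | .run σ D _ =>
      (fun a => (.run (fun j => (a j).elim (σ j) Prod.fst) (refineOrdering D a) a, runTapes s a)) ''
        {a | IsJoint (fun j => M.δ (σ j) fun i => s (some (j, i))) a}

variable [LinearOrder M.Action]

/-- The configuration of the machine `M.choose n` in which the copies have the configurations `c`,
and the input tape is `T`. -/
def runConfig (c : Fin n → M.Config) (D : Fin n → Fin n → Ordering)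
    (a : Fin n → Option M.Action) (T : Turing.Tape M.Symbol) : (M.choose n).Config where
  state := ChooseState.run (fun j => (c j).state) D a
  tape := fun (i : Option (Fin n × Option M.Work)) => match i with
    | none => T
    | some (j, i) => (c j).tape i

/-- The action of `M.choose n` that performs the joint action `a`. -/
def runAction (c : Fin n → M.Config) (D : Fin n → Fin n → Ordering) (T : Turing.Tape M.Symbol)
    (a : Fin n → Option M.Action) : (M.choose n).Action :=
  (ChooseState.run (fun j => (a j).elim (c j).state Prod.fst) (refineOrdering D a) a,
    runTapes (fun i => ((runConfig c D a T).tape i).head) a)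

/-- The joint action recorded in the state to which an action leads. -/
def recorded (b : (M.choose n).Action) : Fin n → Option M.Action :=
  match (show ChooseState n M.State M.Action from b.1) with
  | .run _ _ a => a
  | _ => fun _ => none

/-- The path of the copy `j` in a joint path. -/
def pathOf (L : List (M.choose n).Action) (j : Fin n) : List M.Action :=
  L.flatMap fun b => (recorded b j).toList

theorem enabled_runConfig (c : Fin n → M.Config) (D : Fin n → Fin n → Ordering)
    (a : Fin n → Option M.Action) (T : Turing.Tape M.Symbol) :
    (M.choose n).enabled (runConfig c D a T) =
      runAction c D T '' {a | IsJoint (fun j => M.enabled (c j)) a} := rfl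

theorem step_runConfig (c : Fin n → M.Config) (D : Fin n → Fin n → Ordering)
    (a' a : Fin n → Option M.Action) (T : Turing.Tape M.Symbol) :
    (M.choose n).step (runConfig c D a' T) (runAction c D T a) =
      runConfig (jointStep c a) (refineOrdering D a) a T := by
  have hstate : (fun j => (a j).elim (c j).state Prod.fst) = fun j => (jointStep c a j).state := by
    funext j
    unfold jointStep
    cases a j <;> rfl
  have htape : ((M.choose n).step (runConfig c D a' T) (runAction c D T a)).tape =
      (runConfig (jointStep c a) (refineOrdering D a) a T).tape := by
    funext i
    rcases (show Option (Fin n × Option M.Work) from i) with _ | ⟨j, i⟩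
    · exact Turing.Tape.write_self T
    · change moveHead (((c j).tape i).write ((a j).elim (((c j).tape i).head, none)
          (fun b => b.2 i)).1) ((a j).elim (((c j).tape i).head, none) (fun b => b.2 i)).2 =
        (jointStep c a j).tape i
      unfold jointStep
      cases a j with
      | none => exact Turing.Tape.write_self ((c j).tape i)
      | some b => rfl
  unfold runConfig
  rw [← hstate]
  exact congrArg (Config.mk _) htape

theorem mem_accept_runConfig (c : Fin n → M.Config) (D : Fin n → Fin n → Ordering)
    (a : Fin n → Option M.Action) (T : Turing.Tape M.Symbol) :
    (runConfig c D a T).state ∈ (M.choose n).accept ↔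
      (∀ j, (c j).state ∈ M.accept) ∧ ∀ i j, i < j → D i j = .lt := by
  constructor
  · rintro ⟨σ, D', a', h, h₁, h₂⟩
    obtain ⟨rfl, rfl, rfl⟩ := ChooseState.run.inj h
    exact ⟨h₁, h₂⟩
  · rintro ⟨h₁, h₂⟩
    exact ⟨_, _, _, rfl, h₁, h₂⟩

theorem enabled_runConfig_eq_empty_iff {c : Fin n → M.Config} {D : Fin n → Fin n → Ordering}
    {a : Fin n → Option M.Action} {T : Turing.Tape M.Symbol} :
    (M.choose n).enabled (runConfig c D a T) = ∅ ↔ ∀ j, M.enabled (c j) = ∅ := by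
  rw [enabled_runConfig, Set.image_eq_empty, Set.eq_empty_iff_forall_notMem]
  constructor
  · classical
    intro h
    by_contra! hne
    obtain ⟨j, hj⟩ := hne
    refine h (fun j => if h : (M.enabled (c j)).Nonempty then some h.some else none)
      ⟨⟨j, by simp [hj]⟩, fun i => ?_⟩
    by_cases hi : (M.enabled (c i)).Nonempty
    · simp only [hi, dite_true, Option.some.injEq, reduceCtorEq, false_imp_iff, and_true]
      rintro _ rfl
      exact hi.some_mem
    · simpa [hi] using Set.not_nonempty_iff_eq_empty.1 hi
  · rintro h a ⟨⟨j, hj⟩, ha⟩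
    obtain ⟨b, hb⟩ := Option.ne_none_iff_exists'.1 hj
    simpa [h j] using (ha j).1 b hb

theorem bounded_runConfig {c : Fin n → M.Config} {t : ℕ} (h : ∀ j, M.Bounded (c j) t)
    (D : Fin n → Fin n → Ordering) (a : Fin n → Option M.Action) (T : Turing.Tape M.Symbol) :
    (M.choose n).Bounded (runConfig c D a T) t := by
  induction t generalizing c D a with
  | zero =>
    simp only [bounded_zero_iff] at h
    rwa [bounded_zero_iff, enabled_runConfig_eq_empty_iff]
  | succ t ih =>
    rw [bounded_succ_iff, enabled_runConfig]
    rintro _ ⟨a, ⟨-, ha⟩, rfl⟩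
    rw [step_runConfig]
    refine ih (fun j => ?_) _ _
    unfold jointStep
    cases hj : a j with
    | none => exact bounded_of_enabled_eq_empty ((ha j).2 hj) t
    | some b => exact bounded_succ_iff.1 (h j) b ((ha j).1 b hj)

/-- The tuples of accepting paths from `c` whose members increase, if their parts before have
compared as recorded in `D`. -/
def increasingTuples (c : Fin n → M.Config) (D : Fin n → Fin n → Ordering) :
    Set (Fin n → List M.Action) :=
  {p | (∀ j, p j ∈ M.accPaths (c j)) ∧ ∀ i j, i < j → PrecedesAfter (D i j) (p i) (p j)}

theorem append_mem_increasingTuples {c : Fin n → M.Config} {D : Fin n → Fin n → Ordering}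
    {a : Fin n → Option M.Action} (ha : IsJoint (fun j => M.enabled (c j)) a)
    (p : Fin n → List M.Action) :
    (fun j => (a j).toList ++ p j) ∈ increasingTuples c D ↔
      p ∈ increasingTuples (jointStep c a) (refineOrdering D a) := by
  simp only [increasingTuples, Set.mem_ofPred_eq, toList_append_mem_accPaths ha]
  refine and_congr_right fun hp => forall₃_congr fun i j _ => ?_
  exact precedesAfter_append (eq_nil_of_mem_accPaths_jointStep ha (hp i))
    (eq_nil_of_mem_accPaths_jointStep ha (hp j))

theorem nil_mem_accPaths_runConfig {c : Fin n → M.Config} {D : Fin n → Fin n → Ordering}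
    {a : Fin n → Option M.Action} {T : Turing.Tape M.Symbol} :
    [] ∈ (M.choose n).accPaths (runConfig c D a T) ↔ (fun _ => []) ∈ increasingTuples c D := by
  rw [nil_mem_accPaths, enabled_runConfig_eq_empty_iff, mem_accept_runConfig]
  simp [increasingTuples, PrecedesAfter, nil_mem_accPaths, forall_and, and_assoc]

theorem pathOf_mem_increasingTuples {L : List (M.choose n).Action} {c : Fin n → M.Config}
    {D : Fin n → Fin n → Ordering} {a : Fin n → Option M.Action} {T : Turing.Tape M.Symbol}
    (hL : L ∈ (M.choose n).accPaths (runConfig c D a T)) : pathOf L ∈ increasingTuples c D := by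
  induction L generalizing c D a with
  | nil => exact nil_mem_accPaths_runConfig.1 hL
  | cons b L ih =>
    rw [cons_mem_accPaths, enabled_runConfig] at hL
    obtain ⟨⟨a, ha, rfl⟩, hL⟩ := hL
    rw [step_runConfig] at hL
    exact (append_mem_increasingTuples ha _).2 (ih hL)

/-- A joint path is determined by the paths of the copies. -/
theorem pathOf_injOn (c : Fin n → M.Config) (D : Fin n → Fin n → Ordering)
    (a : Fin n → Option M.Action) (T : Turing.Tape M.Symbol) :
    Set.InjOn pathOf ((M.choose n).accPaths (runConfig c D a T)) := by
  intro L hL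
  induction L generalizing c D a with
  | nil =>
    intro L' hL' _
    exact (eq_nil_of_mem_accPaths (nil_mem_accPaths.1 hL).1 hL').symm
  | cons b L ih =>
    rintro (_ | ⟨b', L'⟩) hL' h
    · exact eq_nil_of_mem_accPaths (nil_mem_accPaths.1 hL').1 hL
    · rw [cons_mem_accPaths, enabled_runConfig] at hL hL'
      obtain ⟨⟨a₁, ha₁, rfl⟩, hL⟩ := hL
      obtain ⟨⟨a₂, ha₂, rfl⟩, hL'⟩ := hL'
      rw [step_runConfig] at hL hL'
      have happ : ∀ j, (a₁ j).toList ++ pathOf L j = (a₂ j).toList ++ pathOf L' j := congrFun h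
      -- A copy idles in neither or both of the joint actions, because this depends only on `c`.
      have hj : ∀ j, a₁ j = a₂ j ∧ pathOf L j = pathOf L' j := by
        intro j
        have h₁ := ha₁.2 j
        have h₂ := ha₂.2 j
        have hj := happ j
        rcases h₁' : a₁ j with _ | x <;> rcases h₂' : a₂ j with _ | y
        · simpa [h₁', h₂'] using hj
        · have := h₂.1 y h₂'
          rw [h₁.2 h₁'] at this
          exact this.elim
        · have := h₁.1 x h₁'
          rw [h₂.2 h₂'] at this
          exact this.elim
        · simpa [h₁', h₂'] using hj
      obtain rfl : a₁ = a₂ := funext fun j => (hj j).1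
      rw [ih _ _ _ hL hL' (funext fun j => (hj j).2)]

/-- Every increasing tuple of accepting paths is carried out by an accepting joint path; `t` bounds
the number of steps that it takes. -/
theorem exists_pathOf_eq {t : ℕ} {c : Fin n → M.Config} {D : Fin n → Fin n → Ordering}
    {p : Fin n → List M.Action} (hp : p ∈ increasingTuples c D) (ht : ∀ j, (p j).length ≤ t)
    (a : Fin n → Option M.Action) (T : Turing.Tape M.Symbol) :
    ∃ L ∈ (M.choose n).accPaths (runConfig c D a T), pathOf L = p := by
  induction t generalizing c D a p with
  | zero =>
    obtain rfl : p = fun _ => [] := funext fun j => by simpa using ht j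
    exact ⟨[], nil_mem_accPaths_runConfig.2 hp, rfl⟩
  | succ t ih =>
    by_cases hnil : ∀ j, p j = []
    · obtain rfl : p = fun _ => [] := funext hnil
      exact ⟨[], nil_mem_accPaths_runConfig.2 hp, rfl⟩
    obtain ⟨j₀, hj₀⟩ := not_forall.1 hnil
    let a' : Fin n → Option M.Action := fun j => (p j).head?
    have hp' : p = fun j => (a' j).toList ++ (p j).tail := by
      funext j
      cases h : p j <;> simp [a', h]
    have ha' : IsJoint (fun j => M.enabled (c j)) a' := by
      refine ⟨⟨j₀, by simpa [a'] using hj₀⟩, fun j => ?_⟩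
      have hj := hp.1 j
      cases h : p j with
      | nil =>
        rw [h, nil_mem_accPaths] at hj
        simp [a', h, hj.1]
      | cons b l =>
        rw [h, cons_mem_accPaths] at hj
        simp [a', h, hj.1]
    rw [hp', append_mem_increasingTuples ha'] at hp
    obtain ⟨L, hL, hLp⟩ := ih hp (fun j => by have := ht j; simp; omega) a'
    refine ⟨runAction c D T a' :: L, cons_mem_accPaths.2 ⟨⟨a', ha', rfl⟩, ?_⟩, ?_⟩
    · rwa [step_runConfig]
    · refine Eq.trans ?_ hp'.symm
      exact funext fun j => congrArg ((a' j).toList ++ ·) (congrFun hLp j)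

theorem encard_accPaths_runConfig (c : Fin n → M.Config) (D : Fin n → Fin n → Ordering)
    (a : Fin n → Option M.Action) (T : Turing.Tape M.Symbol) :
    ((M.choose n).accPaths (runConfig c D a T)).encard = (increasingTuples c D).encard := by
  rw [← (pathOf_injOn c D a T).encard_image]
  congr 1
  ext p
  constructor
  · rintro ⟨L, hL, rfl⟩
    exact pathOf_mem_increasingTuples hL
  · intro hp
    exact exists_pathOf_eq hp (fun j => Finset.single_le_sum (f := fun j => (p j).length)
      (fun _ _ => Nat.zero_le _) (Finset.mem_univ j)) a T

/-- When all copies start in the configuration `c`, the accepting joint paths are the increasing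
tuples of accepting paths from `c`. -/
theorem counts_runConfig {c : M.Config} {N t : ℕ} (h : M.Counts c N t)
    (a : Fin n → Option M.Action) (T : Turing.Tape M.Symbol) :
    (M.choose n).Counts (runConfig (fun _ => c) (fun _ _ => .eq) a T) (N.choose n) t := by
  refine ⟨?_, bounded_runConfig (fun _ => h.2) _ _ _⟩
  rw [encard_accPaths_runConfig, ← encard_strictMono_tuples h.1 n]
  simp [increasingTuples, PrecedesAfter]

/-! ### Copying the input -/

/-- The configurations of `M.choose n` before the copies start: the input tape is `T`, its copies are
`T'`, and all other tapes are blank. -/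
def copyConfig (q : ChooseState n M.State M.Action) (T T' : Turing.Tape M.Symbol) :
    (M.choose n).Config where
  state := q
  tape := fun (i : Option (Fin n × Option M.Work)) => match i with
    | none => T
    | some (_, none) => T'
    | some (_, some _) => Turing.Tape.mk₁ []

/-- The action that goes to the state `q`, with the effect `M.copyTapes n s d` on the tapes. -/
def copyAction (q : ChooseState n M.State M.Action) (s : M.Symbol) (d : Turing.Dir) :
    (M.choose n).Action :=
  (q, M.copyTapes n s d)

theorem step_copyConfig (q q' : ChooseState n M.State M.Action) (T T' : Turing.Tape M.Symbol)
    (s : M.Symbol) (d : Turing.Dir) :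
    (M.choose n).step (copyConfig q T T') (copyAction q' s d) =
      copyConfig q' ((T.write s).move d) ((T'.write s).move d) := by
  refine congrArg (Config.mk (M := M.choose n) q')
    (funext fun i : Option (Fin n × Option M.Work) => ?_)
  rcases i with _ | ⟨j, _ | i⟩ <;> rfl

theorem enabled_forward_blank {T T' : Turing.Tape M.Symbol} (h : T.head = M.sym none) :
    (M.choose n).enabled (copyConfig .forward T T') = {copyAction .backward T.head .left} :=
  congrArg singleton (if_pos h)

theorem enabled_forward {T T' : Turing.Tape M.Symbol} (h : T.head ≠ M.sym none) :
    (M.choose n).enabled (copyConfig .forward T T') = {copyAction .forward T.head .right} :=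
  congrArg singleton (if_neg h)

theorem enabled_backward_blank {T T' : Turing.Tape M.Symbol} (h : T.head = M.sym none) :
    (M.choose n).enabled (copyConfig .backward T T') =
      {copyAction (.run (fun _ => M.start) (fun _ _ => .eq) fun _ => none) T.head .right} :=
  congrArg singleton (if_pos h)

theorem enabled_backward {T T' : Turing.Tape M.Symbol} (h : T.head ≠ M.sym none) :
    (M.choose n).enabled (copyConfig .backward T T') = {copyAction .backward T.head .left} :=
  congrArg singleton (if_neg h)

theorem copyConfig_run (x : List Bool) :
    copyConfig (n := n) (.run (fun _ => M.start) (fun _ _ => .eq) fun _ => none)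
      (wordTape M [] x) (wordTape M [] x) =
    runConfig (fun _ => M.init x) (fun _ _ => .eq) (fun _ => none) (wordTape M [] x) := by
  refine congrArg (Config.mk (M := M.choose n) _)
    (funext fun i : Option (Fin n × Option M.Work) => ?_)
  rcases i with _ | ⟨j, _ | i⟩ <;> rfl

/-- While the heads return, the input tape and its copies agree. The configuration is that in which
the heads are on the last symbol of `l.reverse`, or on the blank before the input if `l` is empty. -/
theorem counts_backward {x : List Bool} {N t : ℕ} (h : M.Counts (M.init x) N t)
    (l r : List Bool) (hx : l.reverse ++ r = x) :
    (M.choose n).Counts (copyConfig .backward ((wordTape M l r).move .left)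
      ((wordTape M l r).move .left)) (N.choose n) (t + 1 + l.length) := by
  induction l generalizing r with
  | nil =>
    obtain rfl : r = x := by simpa using hx
    have hb : ((wordTape M [] r).move .left).head = M.sym none := rfl
    refine Counts.of_step (enabled_backward_blank hb) ?_
    rw [step_copyConfig, Turing.Tape.write_self, Turing.Tape.move_left_right, copyConfig_run]
    exact counts_runConfig h _ _
  | cons b l ih =>
    have hm : (wordTape M (b :: l) r).move .left = wordTape M l (b :: r) := by
      rw [← move_right_wordTape, Turing.Tape.move_right_left]
    rw [hm]
    refine Counts.of_step (enabled_backward (sym_some_ne_blank b)) ?_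
    rw [step_copyConfig, Turing.Tape.write_self]
    exact ih (b :: r) (by simpa using hx)

/-- While the input is being copied, the copies hold the part to the left of the head. -/
theorem counts_forward {x : List Bool} {N t : ℕ} (h : M.Counts (M.init x) N t)
    (l r : List Bool) (hx : l.reverse ++ r = x) :
    (M.choose n).Counts (copyConfig .forward (wordTape M l r) (wordTape M l []))
      (N.choose n) (t + x.length + 2 + r.length) := by
  induction r generalizing l with
  | nil =>
    refine Counts.of_step (enabled_forward_blank (wordTape_head_nil l)) ?_
    rw [step_copyConfig, Turing.Tape.write_self]
    have := counts_backward (n := n) h l [] hx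
    rw [← hx, List.append_nil, List.length_reverse, add_right_comm]
    exact this
  | cons b r ih =>
    refine Counts.of_step (enabled_forward (sym_some_ne_blank b)) ?_
    rw [step_copyConfig, Turing.Tape.write_self, wordTape_head_cons, write_wordTape_nil,
      move_right_wordTape, move_right_wordTape]
    exact ih (b :: l) (by simpa using hx)

theorem init_choose (x : List Bool) :
    (M.choose n).init x = copyConfig .forward (wordTape M [] x) (wordTape M [] []) := by
  refine congrArg (Config.mk (M := M.choose n) _)
    (funext fun i : Option (Fin n × Option M.Work) => ?_)
  rcases i with _ | ⟨j, _ | i⟩ <;> rfl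

theorem counts_choose {x : List Bool} {N t : ℕ} (h : M.Counts (M.init x) N t) :
    (M.choose n).Counts ((M.choose n).init x) (N.choose n) (t + x.length + 2 + x.length) := by
  rw [init_choose]
  exact counts_forward h [] x rfl

end Choose

end NTM

/-- #P is closed under binomial coefficients with a constant lower index. -/
theorem SharpP.choose {f : List Bool → ℕ} (hf : f ∈ SharpP) (n : ℕ) :
    (fun x => (f x).choose n) ∈ SharpP := by
  obtain ⟨M, p, h⟩ := SharpP.exists_counts hf
  obtain ⟨k, ⟨e⟩⟩ := Finite.exists_equiv_fin M.Action
  let : LinearOrder M.Action := LinearOrder.lift' e e.injective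
  refine mem_sharpP_of_counts (M.choose n) (p + 2 * Polynomial.X + 2) fun x => ?_
  have := NTM.counts_choose (n := n) (h x)
  have hp : (p + 2 * Polynomial.X + 2).eval x.length = p.eval x.length + x.length + 2 + x.length := by
    simp only [Polynomial.eval_add, Polynomial.eval_mul, Polynomial.eval_X, Polynomial.eval_ofNat]
    ring
  rwa [hp]

/-! ### Complements of languages in UP -/

/-- If a function in #P has the value `m` on `L` and a greater value `n` elsewhere, then the number
of `n`-subsets of its accepting paths is the indicator function of the complement of `L`. -/
theorem compl_mem_UP {L : Set (List Bool)} {g : List Bool → ℕ} (hg : g ∈ SharpP) {m n : ℕ}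
    (hmn : m < n) (hL : ∀ w ∈ L, g w = m) (hLc : ∀ w ∉ L, g w = n) : Lᶜ ∈ UP := by
  have h : Lᶜ.indicator (fun _ => 1) = fun w => (g w).choose n := by
    funext w
    by_cases hw : w ∈ L
    · simp [hw, hL w hw, Nat.choose_eq_zero_of_lt hmn]
    · simp [hw, hLc w hw]
  change Lᶜ.indicator (fun _ => 1) ∈ SharpP
  rw [h]
  exact SharpP.choose hg n

theorem UP_eq_coUP_of_compl (h : ∀ L ∈ UP, Lᶜ ∈ UP) : UP = coUP := by
  ext L
  exact ⟨h L, fun hL => by simpa using h Lᶜ hL⟩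

/-- A function on tuples that is not monotone decreases somewhere in a single step. -/
theorem exists_lt_of_not_monotone {k : ℕ} {φ : (Fin k → ℕ) → ℕ} (h : ¬ Monotone φ) :
    ∃ (a : Fin k → ℕ) (i : Fin k), φ (a + Pi.single i 1) < φ a := by
  contrapose! h
  intro a b hab
  obtain ⟨d, rfl⟩ := exists_add_of_le hab
  have hd : d = ∑ i, d i • (Pi.single i 1 : Fin k → ℕ) := by
    funext j
    simp [Finset.sum_apply, Pi.single_apply]
  clear hab
  have key : ∀ (i : Fin k) (t : ℕ) (a : Fin k → ℕ), φ a ≤ φ (a + t • Pi.single i 1) := by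
    intro i t
    induction t with
    | zero => simp
    | succ t ih =>
      intro a
      rw [succ_nsmul, ← add_assoc]
      exact (ih a).trans (h _ i)
  have hs : ∀ s : Finset (Fin k), φ a ≤ φ (a + ∑ i ∈ s, d i • (Pi.single i 1 : Fin k → ℕ)) := by
    intro s
    induction s using Finset.cons_induction with
    | empty => simp
    | cons i s hi ih =>
      rw [Finset.sum_cons, add_comm (d i • _), ← add_assoc]
      exact ih.trans (key i (d i) _)
  rw [hd]
  exact hs _

/-- Suppose that `Φ` of functions in #P is in #P, and that `Φ` decreases from `a` to `a + eᵢ`. For a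
language `L` in UP, apply `Φ` to the constants `a`, with the characteristic function of `L` added to
the `i`-th one: the result takes the smaller of the two values of `Φ` on `L`, the greater elsewhere. -/
theorem UP_eq_coUP_of_decrease {k : ℕ} {Φ : (Fin k → ℕ) → ℚ}
    (hΦ : ∀ f : Fin k → List Bool → ℕ, (∀ j, f j ∈ SharpP) →
      ∃ g ∈ SharpP, ∀ w, (g w : ℚ) = Φ fun j => f j w)
    (a : Fin k → ℕ) (i : Fin k) {m n : ℕ} (hmn : m < n)
    (hm : Φ (a + Pi.single i 1) = m) (hn : Φ a = n) : UP = coUP := by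
  refine UP_eq_coUP_of_compl fun L hL => ?_
  let f : Fin k → List Bool → ℕ := fun j w => (if j = i then L.indicator (fun _ => 1) w else 0) + a j
  have hf : ∀ j, f j ∈ SharpP := fun j => by
    by_cases hj : j = i
    · simpa [f, hj] using SharpP.add_const hL (a i)
    · simpa [f, hj] using SharpP.const (a j)
  obtain ⟨g, hg, hgΦ⟩ := hΦ f hf
  refine compl_mem_UP hg hmn (fun w hw => ?_) (fun w hw => ?_)
  · have : (fun j => f j w) = a + Pi.single i 1 := by
      funext j
      simp [f, hw, Pi.single_apply, add_comm]
    rw [← Nat.cast_inj (R := ℚ), hgΦ, this, hm]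
  · have : (fun j => f j w) = a := by
      funext j
      simp [f, hw]
    rw [← Nat.cast_inj (R := ℚ), hgΦ, this, hn]

/-- A difference of polynomials `φ ≥_# ψ` that decreases in a unit step yields UP = coUP. -/
theorem SharpGE.UP_eq_coUP {k : ℕ} {φ ψ : MvPolynomial (Fin k) ℚ} (h : SharpGE φ ψ)
    (a : Fin k → ℕ) (i : Fin k) {m n : ℕ} (hmn : m < n)
    (hm : MvPolynomial.eval (fun j => (((a + Pi.single i 1 : Fin k → ℕ) j : ℕ) : ℚ)) φ -
      MvPolynomial.eval (fun j => (((a + Pi.single i 1 : Fin k → ℕ) j : ℕ) : ℚ)) ψ = m)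
    (hn : MvPolynomial.eval (fun j => (a j : ℚ)) φ - MvPolynomial.eval (fun j => (a j : ℚ)) ψ = n) :
    UP = coUP :=
  UP_eq_coUP_of_decrease (Φ := fun v => MvPolynomial.eval (fun j => (v j : ℚ)) φ -
    MvPolynomial.eval (fun j => (v j : ℚ)) ψ) h a i hmn hm hn

theorem proposition2 :
    (∀ (k : ℕ), 1 ≤ k → ∀ φ : (Fin k → ℕ) → ℕ,
      ¬ Monotone φ → IsClosureProperty φ → UP = coUP) ∧
    (SharpGE ((MvPolynomial.X 0 - 1) ^ 2 : MvPolynomial (Fin 1) ℚ) 0 → UP = coUP) ∧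
    (SharpGE (MvPolynomial.X 0 ^ 2 + MvPolynomial.X 1 ^ 2 : MvPolynomial (Fin 2) ℚ)
      (MvPolynomial.X 0 * MvPolynomial.X 1) → UP = coUP) ∧
    (SharpGE (MvPolynomial.X 0 ^ 2 - MvPolynomial.X 0 * MvPolynomial.X 1 + MvPolynomial.X 1 ^ 2 :
      MvPolynomial (Fin 2) ℚ) 0 → UP = coUP) ∧
    (SharpGE (MvPolynomial.X 0 ^ 2 * MvPolynomial.X 1 ^ 4 + MvPolynomial.X 0 ^ 4 * MvPolynomial.X 1 ^ 2
      - 3 * MvPolynomial.X 0 ^ 2 * MvPolynomial.X 1 ^ 2 + 1 : MvPolynomial (Fin 2) ℚ) 0 →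
      UP = coUP) := by
  refine ⟨fun k _ φ hmono hφ => ?_, fun h => ?_, fun h => ?_, fun h => ?_, fun h => ?_⟩
  · obtain ⟨a, i, hlt⟩ := exists_lt_of_not_monotone hmono
    exact UP_eq_coUP_of_decrease (Φ := fun v => (φ v : ℚ))
      (fun f hf => ⟨_, hφ f hf, fun _ => rfl⟩) a i hlt rfl rfl
  · refine h.UP_eq_coUP ![0] 0 one_pos ?_ ?_ <;> simp
  · refine h.UP_eq_coUP ![2, 0] 1 (show 3 < 4 by norm_num) ?_ ?_ <;> norm_num
  · refine h.UP_eq_coUP ![2, 0] 1 (show 3 < 4 by norm_num) ?_ ?_ <;> norm_num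
  · refine h.UP_eq_coUP ![1, 0] 1 one_pos ?_ ?_ <;> norm_num
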